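/- Let $k$ be a field, $R=k[x_0,\dots,x_n]$, let $1\le c<s$ be integers, and let $F_1,\dots,F_s\in R$ be homogeneous polynomials such that any $c+1$ of them (i.e. with distinct indices, in any order) form a regular sequence in $R$. Let $$I_c=\bigcap_{1\le j_1<\cdots<j_c\le s}(F_{j_1},\dots,F_{j_c})$$ be the ideal of the star configuration of height $c$ on $F_1,\dots,F_s$, and for $m\ge 1$ let $$I_c^{(m)}=\bigcap_{P\in\operatorname{Ass}(R/I_c)}\bigl(I_c^mR_P\cap R\bigr)$$ be its $m$-th symbolic power. A monomial in the $F_i$ is a product $M$ of some of the $F_i$, repetitions allowed. Such an $M$ can be written uniquely in normal form $$M=M^{(1)}M^{(2)}\cdots M^{(t)},\qquad M^{(j)}=\prod_{i\in S_j}F_i,\qquad \{1,\dots,s\}\supseteq S_1\supseteq S_2\supseteq\cdots\supseteq S_t\ne\emptyset$$ (with $t=0$ if $M=1$). Write $|\operatorname{supp}(M^{(j)})|=|S_j|$ and define the symbolic degree of $M$ by $$\operatorname{Sdeg}(M)=\sum_{j=1}^t\max\{0,\,c-s+|\operatorname{supp}(M^{(j)})|\}.$$ Then for every $m\ge 1$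 the set $$\mathbf G_{c,(m)}=\bigl\{M \text{ a monomial in the } F_i \;:\; \operatorname{Sdeg}(M)=m \text{ and } |\operatorname{supp}(M^{(j)})|\ge s+1-c \text{ for every factor } M^{(j)} \text{ of the normal form of } M\bigr\}$$ is a minimal generating set of the ideal $I_c^{(m)}$: it generates $I_c^{(m)}$, and no proper subset of it does. -/

import Mathlib

noncomputable section

/-- The `m`-th symbolic power of an ideal `I`: the intersection, over all associated primes `P`
of `R ⧸ I`, of the contractions `I ^ m R_P ∩ R`. -/
def symbolicPower {R : Type*} [CommRing R] (I : Ideal R) (m : ℕ) : Ideal R :=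
  ⨅ (P : Ideal R) (hP : P ∈ associatedPrimes R (R ⧸ I)),
    haveI : P.IsPrime := hP.isPrime
    ((I ^ m).map (algebraMap R (Localization.AtPrime P))).comap
      (algebraMap R (Localization.AtPrime P))

/-- The ideal `I_{c,F}` of the star configuration of height `c` on `F₁, …, F_s`: the intersection
of the ideals generated by `c` of the forms. -/
def starConfigurationIdeal {R : Type*} [CommRing R] {s : ℕ} (c : ℕ) (F : Fin s → R) : Ideal R :=
  ⨅ J ∈ Finset.powersetCard c (Finset.univ : Finset (Fin s)), Ideal.span (F '' (J : Set (Fin s)))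

/-- `M` is a monomial in `F`: a product, possibly with repetitions, of the `F i`. -/
def IsMonomialIn {R : Type*} [CommRing R] {s : ℕ} (F : Fin s → R) (M : R) : Prop :=
  M ∈ Submonoid.closure (Set.range F)

/-- The list `[S₁, …, S_t]` of index sets gives a normal form `M = M⁽¹⁾ ⋯ M⁽ᵗ⁾` of `M` with respect
to `F`: here `M⁽ʲ⁾ = ∏ i ∈ S_j, F i` is the squarefree monomial with support `S_j`, the supports
are nonempty, and `S₁ ⊇ S₂ ⊇ ⋯ ⊇ S_t`. -/
structure IsNormalForm {R : Type*} [CommRing R] {s : ℕ} (F : Fin s → R) (M : R)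
    (L : List (Finset (Fin s))) : Prop where
  nonempty : ∀ S ∈ L, S.Nonempty
  decreasing : L.Pairwise (fun S T => T ⊆ S)
  prod_eq : (L.map fun S => ∏ i ∈ S, F i).prod = M

open Classical in
/-- The list of supports of the factors in the normal form of `M` (empty if there is none). For
every monomial in pairwise coprime non-unit forms over a field the normal form exists and is
unique, so that nothing depends on the choice. -/
def normalForm {R : Type*} [CommRing R] {s : ℕ} (F : Fin s → R) (M : R) :
    List (Finset (Fin s)) :=
  if h : ∃ L, IsNormalForm F M L then h.choose else []

/-- The symbolic degree `∑ j, max {0, c - s + |supp M⁽ʲ⁾|}` of `M`, the sum running over the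
factors of the normal form. Truncated subtraction of natural numbers is the maximum with `0`. -/
def symbolicDegree {R : Type*} [CommRing R] {s : ℕ} (c : ℕ) (F : Fin s → R) (M : R) : ℕ :=
  ((normalForm F M).map fun S => c + S.card - s).sum

/-- The monomials `M` in `F` of symbolic degree `m` such that every factor of the normal form of
`M` has support of size at least `s + 1 - c`. -/
def symbolicGenerators {R : Type*} [CommRing R] {s : ℕ} (c m : ℕ) (F : Fin s → R) : Set R :=
  {M | IsMonomialIn F M ∧ symbolicDegree c F M = m ∧
    ∀ S ∈ normalForm F M, s + 1 ≤ S.card + c}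

/-- `G` is a minimal generating set of the ideal `I`: it generates `I`, and no proper subset of it
does. -/
def IsMinimalGeneratingSet {R : Type*} [CommRing R] (I : Ideal R) (G : Set R) : Prop :=
  Minimal (fun A : Set R => Ideal.span A = I) G

end

/-! For a set `J` of `c` indices write `(F_J)` for the ideal of the `F i`, `i ∈ J`. Any `c` of the
forms are quasi-regular: if a combination of monomials lies in a high power of `(F_J)`, the
coefficient of a monomial that no other one divides on `J` lies in `(F_J)`
(`IsGenericFamily.coeff_mem`). The proof rests on this principle. It shows that powers of `(F_J)`
acquire no new associated primes, so the symbolic power is the intersection of all `(F_J) ^ m`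
(`IsGenericFamily.symbolicPower_starConfigurationIdeal`). By induction on `m` this intersection is
spanned by the monomials whose exponents have sum at least `m` over every `J`
(`IsGenericFamily.iInf_span_pow_eq`). An element of order `m + 1` is a combination of minimal
monomials of order `m`. The coefficient of such a monomial lies in `(F_J)` for every `J` containing
the indices where the exponent is below its maximum. The intersection of these ideals is known
(`IsGenericFamily.mem_span_sup_span_prod`), and each of its generators raises the order of the
monomial. The minimal exponents correspond to the given normal forms
(`IsGenericFamily.symbolicGenerators_eq`). None of them is redundant, since a relation would put a
unit coefficient into a proper ideal `(F_J)` (`IsGenericFamily.familyMonomial_notMem_span`). -/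

set_option linter.unusedSectionVars false

/-- `F` is generic up to level `c`: any `c` of its members generate a proper ideal, modulo which
every other member is a nonzerodivisor. -/
structure IsGenericFamily {R ι : Type*} [CommRing R] (F : ι → R) (c : ℕ) : Prop where
  mem_of_mul_mem : ∀ J : Finset ι, J.card ≤ c → ∀ v ∉ J, ∀ x : R,
    F v * x ∈ Ideal.span (F '' (J : Set ι)) → x ∈ Ideal.span (F '' (J : Set ι))
  ne_top : ∀ J : Finset ι, J.card ≤ c → Ideal.span (F '' (J : Set ι)) ≠ ⊤

/-- The ideal generated by the powers `F i ^ n i` for `i ∈ J`. -/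
def powerIdeal {R ι : Type*} [CommRing R] (F : ι → R) (J : Finset ι) (n : ι → ℕ) : Ideal R :=
  Ideal.span ((fun i => F i ^ n i) '' (J : Set ι))

/-- The monomial with exponent `a` in the family `F`. -/
def familyMonomial {R ι : Type*} [CommRing R] [Fintype ι] (F : ι → R) (a : ι → ℕ) : R :=
  ∏ i, F i ^ a i

/-! ### Regular-sequence algebra: nonzerodivisors, quasi-regularity, intersections of the `(F_J)`.
-/

section Generic

variable {R ι : Type*} [CommRing R] [DecidableEq ι] {F : ι → R} {c : ℕ}

theorem powerIdeal_insert (j : ι) (J : Finset ι) (n : ι → ℕ) :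
    powerIdeal F (insert j J) n = Ideal.span {F j ^ n j} ⊔ powerIdeal F J n := by
  rw [powerIdeal, Finset.coe_insert, Set.image_insert_eq, Ideal.span_insert, powerIdeal]

theorem mem_span_singleton_sup {I : Ideal R} {f x : R} :
    x ∈ Ideal.span {f} ⊔ I ↔ ∃ y, x - f * y ∈ I := by
  rw [Submodule.mem_sup]
  constructor
  · rintro ⟨u, hu, v, hv, rfl⟩
    obtain ⟨y, rfl⟩ := Ideal.mem_span_singleton'.1 hu
    exact ⟨y, by convert hv using 1; ring⟩
  · rintro ⟨y, hy⟩
    exact ⟨f * y, Ideal.mul_mem_right _ _ (Ideal.mem_span_singleton_self f), _, hy, by ring⟩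

/-- If `v` is a nonzerodivisor modulo `I + (f)` and `f` is one modulo `I`, then `v` is a
nonzerodivisor modulo `I + (f ^ n)`. -/
theorem mem_span_pow_sup_of_mul_mem {I : Ideal R} {f v : R}
    (hf : ∀ x, f * x ∈ I → x ∈ I)
    (hv : ∀ x, v * x ∈ Ideal.span {f} ⊔ I → x ∈ Ideal.span {f} ⊔ I) (n : ℕ) (x : R)
    (hx : v * x ∈ Ideal.span {f ^ n} ⊔ I) : x ∈ Ideal.span {f ^ n} ⊔ I := by
  induction n generalizing x with
  | zero => simp
  | succ n ih =>
    obtain ⟨z, hz⟩ := mem_span_singleton_sup.1 hx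
    have h1 : x ∈ Ideal.span {f} ⊔ I :=
      hv x (mem_span_singleton_sup.2 ⟨f ^ n * z, by convert hz using 1; ring⟩)
    obtain ⟨y, hy⟩ := mem_span_singleton_sup.1 h1
    -- Modulo `I`, `x = f * y` and `v * x = f ^ (n + 1) * z`; one factor `f` cancels, leaving the
    -- case `n` for `y`.
    have h2 : f * (v * y - f ^ n * z) ∈ I := by
      convert I.sub_mem hz (I.mul_mem_left v hy) using 1; ring
    obtain ⟨w, hw⟩ := mem_span_singleton_sup.1 (ih y (mem_span_singleton_sup.2 ⟨z, hf _ h2⟩))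
    refine mem_span_singleton_sup.2 ⟨w, ?_⟩
    convert I.add_mem hy (I.mul_mem_left f hw) using 1; ring

theorem mem_of_pow_mul_mem {I : Ideal R} {f : R} (hf : ∀ x, f * x ∈ I → x ∈ I) (n : ℕ) (x : R)
    (hx : f ^ n * x ∈ I) : x ∈ I := by
  induction n generalizing x with
  | zero => simpa using hx
  | succ n ih => exact hf _ (ih _ (by convert hx using 1; ring))

theorem mem_of_prod_pow_mul_mem {I : Ideal R} {K : Finset ι} (a : ι → ℕ)
    (hf : ∀ i ∈ K, ∀ x, F i * x ∈ I → x ∈ I) (x : R)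
    (hx : (∏ i ∈ K, F i ^ a i) * x ∈ I) : x ∈ I := by
  induction K using Finset.induction_on generalizing x with
  | empty => simpa using hx
  | insert j K hj ih =>
    rw [Finset.prod_insert hj, mul_assoc] at hx
    exact ih (fun i hi => hf i (Finset.mem_insert_of_mem hi)) x
      (mem_of_pow_mul_mem (hf j (Finset.mem_insert_self j K)) _ _ hx)

/-- Induction on `V`: an index `j` of `V` is either dropped or moved to `L`, where it has exponent
one, and `mem_span_pow_sup_of_mul_mem` restores its exponent. -/
theorem IsGenericFamily.mem_powerIdeal_of_mul_mem (hF : IsGenericFamily F c)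
    (L V : Finset ι) (hLV : (L ∪ V).card ≤ c) (n : ι → ℕ) (v : ι) (hv : v ∉ L ∪ V)
    (hd : Disjoint L V) (x : R)
    (hx : F v * x ∈ powerIdeal F V n ⊔ Ideal.span (F '' (L : Set ι))) :
    x ∈ powerIdeal F V n ⊔ Ideal.span (F '' (L : Set ι)) := by
  induction V using Finset.induction_on generalizing L v x with
  | empty =>
    simp only [powerIdeal, Finset.coe_empty, Set.image_empty, Ideal.span_empty, bot_sup_eq] at hx ⊢
    exact hF.mem_of_mul_mem L (by simpa using hLV) v (by simpa using hv) x hx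
  | insert j V hj ih =>
    rw [powerIdeal_insert, sup_assoc] at hx ⊢
    rw [Finset.disjoint_insert_right] at hd
    have e : insert j L ∪ V = L ∪ insert j V := by
      ext; simp
    have e' : Ideal.span {F j} ⊔ (powerIdeal F V n ⊔ Ideal.span (F '' (L : Set ι))) =
        powerIdeal F V n ⊔ Ideal.span (F '' ((insert j L : Finset ι) : Set ι)) := by
      rw [Finset.coe_insert, Set.image_insert_eq, Ideal.span_insert, sup_left_comm]
    refine mem_span_pow_sup_of_mul_mem (ih L ?_ j ?_ hd.2) ?_ _ x hx
    · exact (Finset.card_le_card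
        (Finset.union_subset_union_right (Finset.subset_insert j V))).trans hLV
    · simp [hj, hd.1]
    · rw [e']
      exact ih (insert j L) (e ▸ hLV) v (e ▸ hv) (Finset.disjoint_insert_left.2 ⟨hj, hd.2⟩)

/-- Quasi-regularity: `(F i ^ (a i + 1) : i ∈ V) : ∏ i ∈ V, F i ^ a i = (F i : i ∈ V)`, relative to
the ideal `(F i : i ∈ L)`. -/
theorem IsGenericFamily.mem_span_of_prod_pow_mul_mem (hF : IsGenericFamily F c)
    (L V : Finset ι) (hLV : (L ∪ V).card ≤ c) (hd : Disjoint L V) (a : ι → ℕ) (r : R)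
    (hr : (∏ i ∈ V, F i ^ a i) * r ∈
      powerIdeal F V (fun i => a i + 1) ⊔ Ideal.span (F '' (L : Set ι))) :
    r ∈ Ideal.span (F '' ((L ∪ V : Finset ι) : Set ι)) := by
  induction V using Finset.induction_on generalizing L with
  | empty => simpa [powerIdeal] using hr
  | insert j V hj ih =>
    rw [powerIdeal_insert, sup_assoc, Finset.prod_insert hj] at hr
    rw [Finset.disjoint_insert_right] at hd
    have e : insert j L ∪ V = L ∪ insert j V := by
      ext; simp
    rw [← e]
    refine ih (insert j L) (e ▸ hLV) (Finset.disjoint_insert_left.2 ⟨hj, hd.2⟩) ?_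
    -- The relation is divisible by `F j ^ a j` up to the remaining ideal. Cancelling it leaves `F
    -- j` in place of `F j ^ (a j + 1)`, so `j` moves to `L`.
    obtain ⟨z, hz⟩ := mem_span_singleton_sup.1 hr
    rw [Finset.coe_insert, Set.image_insert_eq, Ideal.span_insert, sup_left_comm]
    refine mem_span_singleton_sup.2 ⟨z, mem_of_pow_mul_mem
      (hF.mem_powerIdeal_of_mul_mem L V ?_ _ j (by simp [hj, hd.1]) hd.2) (a j) _ ?_⟩
    · exact (Finset.card_le_card
        (Finset.union_subset_union_right (Finset.subset_insert j V))).trans hLV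
    · convert hz using 1; ring

/-- The intersection of the ideals generated by `d` members of `V` and all members of `L` is
generated by `L` and the products of `|V| + 1 - d` members of `V`. -/
theorem IsGenericFamily.mem_span_sup_span_prod (hF : IsGenericFamily F c)
    (L V : Finset ι) (hd : Disjoint L V) (d : ℕ) (hdV : d ≤ V.card) (hLd : L.card + d ≤ c) (x : R)
    (hx : ∀ J ⊆ V, J.card = d → x ∈ Ideal.span (F '' ((L ∪ J : Finset ι) : Set ι))) :
    x ∈ Ideal.span (F '' (L : Set ι)) ⊔
      Ideal.span ((fun U : Finset ι => ∏ i ∈ U, F i) '' {U | U ⊆ V ∧ U.card + d = V.card + 1}) := by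
  induction V using Finset.induction_on generalizing L d x with
  | empty =>
    refine Ideal.mem_sup_left ?_
    simpa using hx ∅ (Finset.Subset.refl _) (by simpa [eq_comm] using hdV)
  | insert v V hv ih =>
    rw [Finset.disjoint_insert_right] at hd
    rw [Finset.card_insert_of_notMem hv] at hdV ⊢
    obtain _ | d := d
    · exact Ideal.mem_sup_left (by simpa using hx ∅ (Finset.empty_subset _) rfl)
    set T := Ideal.span (F '' (L : Set ι)) ⊔ Ideal.span ((fun U : Finset ι => ∏ i ∈ U, F i) ''
      {U | U ⊆ insert v V ∧ U.card + (d + 1) = V.card + 1 + 1}) with hT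
    -- The sets `J` containing `v` give `x = F v * z` modulo `T`; those avoiding `v` then control
    -- `z`, since `F v` cancels.
    have h1 := ih (insert v L) (Finset.disjoint_insert_left.2 ⟨hv, hd.2⟩) d (by omega)
      (by rw [Finset.card_insert_of_notMem hd.1]; omega) x (fun J hJ hJd => by
        have := hx (insert v J) (Finset.insert_subset_insert v hJ)
          (by rw [Finset.card_insert_of_notMem fun h => hv (hJ h), hJd])
        rwa [Finset.union_insert, ← Finset.insert_union] at this)
    rw [Finset.coe_insert, Set.image_insert_eq, Ideal.span_insert, sup_assoc] at h1
    obtain ⟨z, hz⟩ := mem_span_singleton_sup.1 h1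
    have hle : Ideal.span (F '' (L : Set ι)) ⊔ Ideal.span ((fun U : Finset ι => ∏ i ∈ U, F i) ''
        {U | U ⊆ V ∧ U.card + d = V.card + 1}) ≤ T := by
      refine sup_le_sup_left (Ideal.span_mono (Set.image_mono ?_)) _
      rintro U ⟨hU, hc⟩
      exact ⟨hU.trans (Finset.subset_insert v V), by omega⟩
    suffices F v * z ∈ T by
      have := T.add_mem (hle hz) this
      rwa [sub_add_cancel] at this
    -- Here the products have a single factor, so `F v` is itself a generator; the induction for `d
    -- + 1` needs `d < V.card`.
    by_cases hdV' : d = V.card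
    · refine T.mul_mem_right _
        (Ideal.mem_sup_right (Ideal.subset_span ⟨{v}, ⟨by simp, ?_⟩, by simp⟩))
      simp; omega
    have h2 := ih L hd.2 (d + 1) (by omega) hLd z (fun J hJ hJd => by
      have hvJ : v ∉ L ∪ J := by
        simp only [Finset.mem_union, not_or]
        exact ⟨hd.1, fun h => hv (hJ h)⟩
      refine hF.mem_of_mul_mem _ ((Finset.card_union_le _ _).trans (by omega)) v hvJ z ?_
      have hle' : Ideal.span (F '' (L : Set ι)) ⊔
          Ideal.span ((fun U : Finset ι => ∏ i ∈ U, F i) ''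
            {U | U ⊆ V ∧ U.card + d = V.card + 1}) ≤
          Ideal.span (F '' ((L ∪ J : Finset ι) : Set ι)) := by
        refine sup_le (Ideal.span_mono (Set.image_mono (by simp))) (Ideal.span_le.2 ?_)
        rintro _ ⟨U, ⟨hU, hc⟩, rfl⟩
        obtain ⟨i, hi⟩ : (U ∩ J).Nonempty := by
          by_contra h
          rw [Finset.not_nonempty_iff_eq_empty, ← Finset.disjoint_iff_inter_eq_empty] at h
          have := Finset.card_le_card (Finset.union_subset hU hJ)
          rw [Finset.card_union_of_disjoint h] at this
          omega
        rw [Finset.mem_inter] at hi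
        exact Ideal.mem_of_dvd _ (Finset.dvd_prod_of_mem F hi.1)
          (Ideal.subset_span ⟨i, by simp [hi.2], rfl⟩)
      have := Ideal.sub_mem _ (hx J (hJ.trans (Finset.subset_insert v V)) hJd) (hle' hz)
      rwa [sub_sub_cancel] at this)
    obtain ⟨p, hp, q, hq, rfl⟩ := Submodule.mem_sup.1 h2
    rw [mul_add]
    refine T.add_mem (Ideal.mem_sup_left (Ideal.mul_mem_left _ _ hp)) (Ideal.mem_sup_right ?_)
    refine Submodule.span_induction ?_ (by simp) (fun _ _ _ _ h h' => ?_) (fun r _ _ h => ?_) hq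
    · rintro _ ⟨U, ⟨hU, hc⟩, rfl⟩
      have hvU : v ∉ U := fun h => hv (hU h)
      refine Ideal.subset_span ⟨insert v U, ⟨Finset.insert_subset_insert v hU, ?_⟩, ?_⟩
      · rw [Finset.card_insert_of_notMem hvU]; omega
      · simp [Finset.prod_insert hvU]
    · rw [mul_add]; exact Ideal.add_mem _ h h'
    · rw [smul_eq_mul, mul_left_comm]; exact Ideal.mul_mem_left _ _ h

end Generic

/-! ### Monomials in the family and their coefficients. -/

section Monomials

variable {R ι : Type*} [CommRing R] [DecidableEq ι] [Fintype ι] {F : ι → R} {c : ℕ}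

theorem familyMonomial_add (a b : ι → ℕ) :
    familyMonomial F (a + b) = familyMonomial F a * familyMonomial F b := by
  simp [familyMonomial, pow_add, Finset.prod_mul_distrib]

theorem familyMonomial_zero : familyMonomial F 0 = 1 := by
  simp [familyMonomial]

theorem familyMonomial_indicator (U : Finset ι) :
    familyMonomial F (fun i => if i ∈ U then 1 else 0) = ∏ i ∈ U, F i := by
  simp [familyMonomial, pow_ite, Finset.prod_ite_mem]

theorem familyMonomial_single (i : ι) : familyMonomial F (Pi.single i 1) = F i := by
  have := familyMonomial_indicator (F := F) {i}
  rw [Finset.prod_singleton] at this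
  rw [← this]
  congr 1
  ext j
  simp [Pi.single_apply]

theorem familyMonomial_dvd {a b : ι → ℕ} (h : a ≤ b) :
    familyMonomial F a ∣ familyMonomial F b :=
  Finset.prod_dvd_prod_of_dvd _ _ fun i _ => pow_dvd_pow _ (h i)

theorem familyMonomial_eq_mul_compl (J : Finset ι) (a : ι → ℕ) :
    familyMonomial F a = (∏ i ∈ J, F i ^ a i) * ∏ i ∈ Jᶜ, F i ^ a i :=
  (Finset.prod_mul_prod_compl J _).symm

theorem familyMonomial_mem_span_pow (J : Finset ι) (a : ι → ℕ) {l : ℕ} (h : l ≤ ∑ i ∈ J, a i) :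
    familyMonomial F a ∈ Ideal.span (F '' (J : Set ι)) ^ l := by
  rw [familyMonomial_eq_mul_compl J]
  refine Ideal.mul_mem_right _ _ (Ideal.pow_le_pow_right h ?_)
  rw [← Finset.prod_pow_eq_pow_sum]
  exact Ideal.prod_mem_prod fun i hi =>
    Ideal.pow_mem_pow (Ideal.subset_span (Set.mem_image_of_mem F hi)) _

theorem span_pow_le_span_familyMonomial (J : Finset ι) (l : ℕ) :
    Ideal.span (F '' (J : Set ι)) ^ l ≤
      Ideal.span (familyMonomial F '' {a | (∀ i ∉ J, a i = 0) ∧ ∑ i ∈ J, a i = l}) := by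
  induction l with
  | zero =>
    rw [pow_zero, Ideal.one_eq_top, ← (Ideal.eq_top_iff_one _).2]
    exact Ideal.subset_span ⟨0, by simp, familyMonomial_zero⟩
  | succ l ih =>
    rw [pow_succ]
    refine (Ideal.mul_mono_left ih).trans ?_
    rw [Ideal.span_mul_span', Ideal.span_le]
    rintro _ ⟨_, ⟨a, ⟨ha, hal⟩, rfl⟩, _, ⟨j, hj, rfl⟩, rfl⟩
    refine Ideal.subset_span ⟨a + Pi.single j 1, ⟨fun i hi => ?_, ?_⟩, ?_⟩
    · have : i ≠ j := fun h => hi (h ▸ hj)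
      simp [ha i hi, this]
    · have hj' : j ∈ J := hj
      simp [Finset.sum_add_distrib, hal, hj']
    · simp [familyMonomial_add, familyMonomial_single]

theorem familyMonomial_mem_powerIdeal {J : Finset ι} {a n : ι → ℕ} {i : ι} (hi : i ∈ J)
    (h : n i ≤ a i) : familyMonomial F a ∈ powerIdeal F J n := by
  refine Ideal.mem_of_dvd _ ?_ (Ideal.subset_span ⟨i, hi, rfl⟩)
  exact (pow_dvd_pow _ h).trans (Finset.dvd_prod_of_mem (fun i => F i ^ a i) (Finset.mem_univ i))

/-- Pigeonhole: a monomial on `J` of degree `l` exceeds `a` at some index. -/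
theorem span_pow_le_powerIdeal {J : Finset ι} {a : ι → ℕ} {l : ℕ} (h : ∑ i ∈ J, a i < l) :
    Ideal.span (F '' (J : Set ι)) ^ l ≤ powerIdeal F J (fun i => a i + 1) := by
  refine (span_pow_le_span_familyMonomial J l).trans (Ideal.span_le.2 ?_)
  rintro _ ⟨b, ⟨-, hb⟩, rfl⟩
  obtain ⟨i, hi, hlt⟩ := Finset.exists_lt_of_sum_lt (h.trans_eq hb.symm)
  exact familyMonomial_mem_powerIdeal hi hlt

/-- Quasi-regularity removes the factors in `J`; those outside `J` are nonzerodivisors modulo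
`(F_J)`. -/
theorem IsGenericFamily.mem_span_of_familyMonomial_mul_mem (hF : IsGenericFamily F c)
    {J : Finset ι} (hJ : J.card ≤ c) (a : ι → ℕ) (r : R)
    (h : r * familyMonomial F a ∈ powerIdeal F J (fun i => a i + 1)) :
    r ∈ Ideal.span (F '' (J : Set ι)) := by
  have h1 := hF.mem_span_of_prod_pow_mul_mem ∅ J (by simpa using hJ) (by simp) a
    ((∏ i ∈ Jᶜ, F i ^ a i) * r) (by
      rw [familyMonomial_eq_mul_compl J] at h
      refine Ideal.mem_sup_left ?_
      convert h using 1; ring)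
  rw [Finset.empty_union] at h1
  exact mem_of_prod_pow_mul_mem a
    (fun i hi => hF.mem_of_mul_mem J hJ i (Finset.mem_compl.1 hi)) r h1

theorem IsGenericFamily.familyMonomial_injective (hF : IsGenericFamily F c) (hc : 1 ≤ c) :
    Function.Injective (familyMonomial F) := by
  have key : ∀ a b : ι → ℕ, familyMonomial F a = familyMonomial F b → b ≤ a := by
    intro a b hab i
    by_contra! hi
    -- If `a i < b i`, then `1 * F ^ a = F ^ b` lies in `(F i ^ (a i + 1))`, which forces `1 ∈ (F
    -- i)`.
    refine hF.ne_top {i} (by simpa using hc) ((Ideal.eq_top_iff_one _).2 ?_)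
    refine hF.mem_span_of_familyMonomial_mul_mem (by simpa using hc) a 1 ?_
    rw [one_mul, hab]
    exact familyMonomial_mem_powerIdeal (Finset.mem_singleton_self i) hi
  exact fun a b hab => le_antisymm (key b a hab.symm) (key a b hab)

/-- In a combination of monomials lying in a high power of `(F i : i ∈ J)`, the coefficient of a
monomial not divisible, on `J`, by the others lies in `(F i : i ∈ J)`. -/
theorem IsGenericFamily.coeff_mem (hF : IsGenericFamily F c) {J : Finset ι} (hJ : J.card ≤ c)
    {r : (ι → ℕ) →₀ R} {a : ι → ℕ} (hab : ∀ b ∈ r.support, b ≠ a → ∃ i ∈ J, a i < b i)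
    {l : ℕ} (hl : ∑ i ∈ J, a i < l)
    (hsum : Finsupp.linearCombination R (familyMonomial F) r ∈
      Ideal.span (F '' (J : Set ι)) ^ l) :
    r a ∈ Ideal.span (F '' (J : Set ι)) := by
  refine hF.mem_span_of_familyMonomial_mul_mem hJ a _ ?_
  have h1 := span_pow_le_powerIdeal hl hsum
  by_cases ha : a ∈ r.support
  · rw [Finsupp.linearCombination_apply, Finsupp.sum, ← Finset.add_sum_erase _ _ ha] at h1
    refine (Ideal.add_mem_iff_left _ (Ideal.sum_mem _ fun b hb => ?_)).1 h1
    obtain ⟨i, hi, hlt⟩ := hab b (Finset.mem_of_mem_erase hb) (Finset.ne_of_mem_erase hb)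
    exact Ideal.mul_mem_left _ _ (familyMonomial_mem_powerIdeal hi hlt)
  · rw [Finsupp.notMem_support_iff.1 ha, zero_mul]
    exact Ideal.zero_mem _

end Monomials

/-! ### Combinatorics of exponents with bounded partial sums. -/

/-- The exponents all of whose partial sums over `c` indices are at least `m`. -/
def symbolicExponents (ι : Type*) (c m : ℕ) : Set (ι → ℕ) :=
  {a | ∀ J : Finset ι, J.card = c → m ≤ ∑ i ∈ J, a i}

/-- The minimal elements of `symbolicExponents ι c m`: the exponents whose least partial sum
over `c` indices is `m` and which attain their maximum outside fewer than `c` indices. -/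
def minimalExponents (ι : Type*) [Fintype ι] (c m : ℕ) : Set (ι → ℕ) :=
  {a | a ∈ symbolicExponents ι c m ∧ a ∉ symbolicExponents ι c (m + 1) ∧
    ∃ t, (∀ i, a i ≤ t) ∧ (Finset.univ.filter fun i => a i < t).card < c}

section Exponents

variable {ι : Type*} [Fintype ι] [DecidableEq ι] {c m : ℕ}

theorem sum_insert_erase {J : Finset ι} {i j : ι} (hi : i ∉ J) (hj : j ∈ J) (a : ι → ℕ) :
    ∑ l ∈ insert i (J.erase j), a l + a j = ∑ l ∈ J, a l + a i := by
  rw [Finset.sum_insert (fun h => hi (Finset.mem_of_mem_erase h)), ← Finset.add_sum_erase J a hj]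
  ring

theorem card_insert_erase {J : Finset ι} {i j : ι} (hi : i ∉ J) (hj : j ∈ J) :
    (insert i (J.erase j)).card = J.card := by
  rw [Finset.card_insert_of_notMem (fun h => hi (Finset.mem_of_mem_erase h)),
    Finset.card_erase_add_one hj]

/-- An index set of size `c` with least partial sum. -/
theorem exists_isLeast_sum (hc : c ≤ Fintype.card ι) (a : ι → ℕ) :
    ∃ J : Finset ι, J.card = c ∧ (∀ J' : Finset ι, J'.card = c → ∑ i ∈ J, a i ≤ ∑ i ∈ J', a i) ∧
      ∀ i ∉ J, ∀ j ∈ J, a j ≤ a i := by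
  have hne : (Finset.powersetCard c (Finset.univ : Finset ι)).Nonempty :=
    Finset.powersetCard_nonempty.2 hc
  obtain ⟨J, hJ, hmin⟩ := Finset.exists_min_image _ (fun J => ∑ i ∈ J, a i) hne
  have hmin' : ∀ J' : Finset ι, J'.card = c → ∑ i ∈ J, a i ≤ ∑ i ∈ J', a i := fun J' h =>
    hmin J' (Finset.mem_powersetCard.2 ⟨Finset.subset_univ _, h⟩)
  have hJc := (Finset.mem_powersetCard.1 hJ).2
  refine ⟨J, hJc, hmin', fun i hi j hj => ?_⟩
  have h1 := hmin' _ ((card_insert_erase hi hj).trans hJc)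
  have h2 := sum_insert_erase hi hj a
  omega

/-- Each sum is `card * t` minus the deficits `t - a i` it meets. As `J` meets all deficits, the
sums differ by those that `J'` misses. -/
theorem sum_add_sum_sdiff_eq_of_bounded {a : ι → ℕ} {t : ℕ} (ht : ∀ i, a i ≤ t) {J J' : Finset ι}
    (hcard : J.card = J'.card) (hJ : (Finset.univ.filter fun i => a i < t) ⊆ J) :
    ∑ i ∈ J, a i + ∑ i ∈ (Finset.univ.filter fun i => a i < t) \ J', (t - a i) =
      ∑ i ∈ J', a i := by
  have h1 : ∀ K : Finset ι, ∑ i ∈ K, a i +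
      ∑ i ∈ (Finset.univ.filter fun i => a i < t) ∩ K, (t - a i) = K.card * t := by
    intro K
    have : ∑ i ∈ (Finset.univ.filter fun i => a i < t) ∩ K, (t - a i) = ∑ i ∈ K, (t - a i) := by
      refine Finset.sum_subset Finset.inter_subset_right fun i hi h => ?_
      simp only [Finset.mem_inter, Finset.mem_filter, Finset.mem_univ, true_and, hi, and_true,
        not_lt] at h
      omega
    rw [this, ← Finset.sum_add_distrib, Finset.sum_congr rfl fun i _ => Nat.add_sub_cancel' (ht i),
      Finset.sum_const, smul_eq_mul]
  have h2 := h1 J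
  have h3 := h1 J'
  rw [Finset.inter_eq_left.2 hJ] at h2
  have h4 := Finset.sum_inter_add_sum_sdiff (Finset.univ.filter fun i => a i < t) J'
    (fun i => t - a i)
  rw [hcard] at h2
  omega

theorem sum_eq_of_mem_minimalExponents {a : ι → ℕ} (ha : a ∈ symbolicExponents ι c m)
    (ha' : a ∉ symbolicExponents ι c (m + 1)) {t : ℕ} (ht : ∀ i, a i ≤ t) {J : Finset ι}
    (hJc : J.card = c) (hJ : (Finset.univ.filter fun i => a i < t) ⊆ J) : ∑ i ∈ J, a i = m := by
  refine le_antisymm ?_ (ha J hJc)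
  simp only [symbolicExponents, Set.mem_ofPred_eq, not_forall, not_le] at ha'
  obtain ⟨J', hJ', hlt⟩ := ha'
  have := sum_add_sum_sdiff_eq_of_bounded ht (hJc.trans hJ'.symm) hJ
  omega

/-- With `sum_eq_of_mem_minimalExponents`: for a minimal exponent, the `c`-sets of least sum are
exactly those containing every index with a deficit. -/
theorem filter_subset_of_sum_eq {a : ι → ℕ} (ha : a ∈ symbolicExponents ι c m)
    {t : ℕ} (ht : ∀ i, a i ≤ t) (hlt : (Finset.univ.filter fun i => a i < t).card < c)
    {J : Finset ι} (hJc : J.card = c) (hsum : ∑ i ∈ J, a i = m) :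
    (Finset.univ.filter fun i => a i < t) ⊆ J := by
  intro i hi
  by_contra hiJ
  have hcι : c ≤ Fintype.card ι := hJc ▸ Finset.card_le_univ J
  obtain ⟨J', hLJ', hJ'⟩ := Finset.exists_superset_card_eq hlt.le hcι
  have h1 := sum_add_sum_sdiff_eq_of_bounded ht (hJ'.trans hJc.symm) hLJ'
  have h2 := ha J' hJ'
  have h3 : t - a i ≤ ∑ i ∈ (Finset.univ.filter fun i => a i < t) \ J, (t - a i) :=
    Finset.single_le_sum (f := fun i => t - a i) (fun _ _ => Nat.zero_le _)
      (Finset.mem_sdiff.2 ⟨hi, hiJ⟩)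
  have h4 := (Finset.mem_filter.1 hi).2
  omega

/-- Two minimal exponents comparable on a large enough set are equal. -/
theorem eq_of_mem_minimalExponents {a b : ι → ℕ} (ha : a ∈ minimalExponents ι c m)
    (hb : b ∈ minimalExponents ι c m) {t : ℕ} (ht : ∀ i, a i ≤ t)
    (hlt : (Finset.univ.filter fun i => a i < t).card < c) {J : Finset ι} (hJc : J.card = c)
    (hJ : (Finset.univ.filter fun i => a i < t) ⊆ J) (hba : ∀ i ∈ J, b i ≤ a i) : b = a := by
  obtain ⟨hb0, -, u, hu, hult⟩ := hb
  have hsum := sum_eq_of_mem_minimalExponents ha.1 ha.2.1 ht hJc hJ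
  have hsumb : ∑ i ∈ J, b i = m :=
    le_antisymm (hsum ▸ Finset.sum_le_sum hba) (hb0 J hJc)
  have heq : ∀ i ∈ J, b i = a i :=
    (Finset.sum_eq_sum_iff_of_le hba).1 (hsumb.trans hsum.symm)
  -- Both exponents attain their maximum on `J`, where they agree, so the maxima coincide; outside
  -- `J` both are constantly equal to it.
  obtain ⟨j, hjJ, hj⟩ : ∃ j ∈ J, j ∉ Finset.univ.filter fun i => a i < t :=
    Finset.exists_mem_notMem_of_card_lt_card (hlt.trans_eq hJc.symm)
  obtain ⟨j', hjJ', hj'⟩ : ∃ j ∈ J, j ∉ Finset.univ.filter fun i => b i < u :=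
    Finset.exists_mem_notMem_of_card_lt_card (hult.trans_eq hJc.symm)
  simp only [Finset.mem_filter, Finset.mem_univ, true_and, not_lt] at hj hj'
  have hsubb := filter_subset_of_sum_eq hb0 hu hult hJc hsumb
  have hut : u = t := by
    have := heq j hjJ
    have := heq j' hjJ'
    have := hu j
    have := ht j'
    omega
  ext i
  by_cases hi : i ∈ J
  · exact heq i hi
  · have h1 := fun h => hi (hJ h)
    have h2 := fun h => hi (hsubb h)
    simp only [Finset.mem_filter, Finset.mem_univ, true_and, imp_false, not_lt] at h1 h2
    have := hu i
    have := ht i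
    omega

/-- In a componentwise minimal exponent below `a`, every positive entry belongs to a `c`-set of sum
`m`, or it could be lowered. Hence no entry exceeds the largest one on a `c`-set of least sum. -/
theorem exists_le_mem_minimalExponents (hc : 1 ≤ c) (hcι : c ≤ Fintype.card ι) {a : ι → ℕ}
    (ha : a ∈ symbolicExponents ι c m) : ∃ b ≤ a, b ∈ minimalExponents ι c m := by
  obtain ⟨b, hba, hb⟩ := exists_minimal_le_of_wellFoundedLT (· ∈ symbolicExponents ι c m) a ha
  refine ⟨b, hba, ?_⟩
  have hmin : ∀ i, 0 < b i → ∃ J : Finset ι, J.card = c ∧ i ∈ J ∧ ∑ l ∈ J, b l = m := by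
    intro i hi
    by_contra! hcon
    have hle : b - Pi.single i 1 ≤ b := fun l => Nat.sub_le _ _
    have hmem : b - Pi.single i 1 ∈ symbolicExponents ι c m := by
      intro J hJ
      have h1 := hb.1 J hJ
      by_cases hiJ : i ∈ J
      · have h2 := hcon J hJ hiJ
        rw [← Finset.add_sum_erase J _ hiJ] at h1 h2 ⊢
        have : ∑ l ∈ J.erase i, (b - Pi.single i 1 : ι → ℕ) l = ∑ l ∈ J.erase i, b l :=
          Finset.sum_congr rfl fun l hl => by simp [Finset.ne_of_mem_erase hl]
        rw [this]
        simp only [Pi.sub_apply, Pi.single_eq_same]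
        omega
      · refine h1.trans_eq (Finset.sum_congr rfl fun l hl => ?_)
        have : l ≠ i := fun h => hiJ (h ▸ hl)
        simp [this]
    have := hb.2 hmem hle i
    simp at this
    omega
  obtain ⟨J, hJc, hJmin, hswap⟩ := exists_isLeast_sum hcι b
  have hJne : J.Nonempty := Finset.card_pos.1 (by omega)
  obtain ⟨j, hj, hjmax⟩ := Finset.exists_max_image J b hJne
  have hle : ∀ i, b i ≤ b j := by
    intro i
    by_cases hi : i ∈ J
    · exact hjmax i hi
    by_contra! hlt
    obtain ⟨K, hK, hiK, hsum⟩ := hmin i (by omega)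
    -- Exchanging `i` in `K` for some `l ∈ J \ K` with a smaller entry would bring the sum below
    -- `m`.
    have hnot : ¬ J ⊆ K := fun h => hi ((Finset.eq_of_subset_of_card_le h (by omega)) ▸ hiK)
    obtain ⟨l, hlJ, hlK⟩ := Finset.not_subset.1 hnot
    have h1 := hb.1 _ ((card_insert_erase hlK hiK).trans hK)
    have h2 := sum_insert_erase hlK hiK b
    have h3 := hjmax l hlJ
    omega
  refine ⟨hb.1, fun hcon => ?_, b j, hle, ?_⟩
  · have h1 := hcon J hJc
    obtain ⟨i, hi⟩ : ∃ i, 0 < b i := by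
      by_contra! h
      have := Finset.sum_eq_zero (s := J) fun i _ => Nat.le_zero.1 (h i)
      omega
    obtain ⟨K, hK, -, hsum⟩ := hmin i hi
    have := hcon K hK
    omega
  · have : (Finset.univ.filter fun i => b i < b j) ⊆ J.erase j := by
      intro i hi
      have hi' := (Finset.mem_filter.1 hi).2
      refine Finset.mem_erase.2 ⟨fun h => by simp [h] at hi', ?_⟩
      by_contra h
      have := hswap i h j hj
      omega
    have h1 := Finset.card_le_card this
    rw [Finset.card_erase_of_mem hj] at h1
    omega

theorem add_indicator_mem_symbolicExponents {a : ι → ℕ} (ha : a ∈ symbolicExponents ι c m)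
    {U : Finset ι} (hU : ∀ J : Finset ι, J.card = c → ∑ i ∈ J, a i = m → (U ∩ J).Nonempty) :
    (a + fun i => if i ∈ U then 1 else 0) ∈ symbolicExponents ι c (m + 1) := by
  intro J hJ
  have h1 := ha J hJ
  simp only [Pi.add_apply, Finset.sum_add_distrib]
  by_cases h : ∑ i ∈ J, a i = m
  · have := (hU J hJ h).card_pos
    rw [Finset.inter_comm] at this
    simp only [Finset.sum_ite_mem, Finset.sum_const, smul_eq_mul, mul_one]
    omega
  · omega

end Exponents

/-! ### The intersection of the powers `(F_J) ^ m` and its minimal monomial generators. -/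

section Intersection

variable {R ι : Type*} [CommRing R] [DecidableEq ι] [Fintype ι] {F : ι → R} {c : ℕ}

theorem span_symbolicExponents_eq (hc : 1 ≤ c) (hcι : c ≤ Fintype.card ι) (m : ℕ) :
    Ideal.span (familyMonomial F '' symbolicExponents ι c m) =
      Ideal.span (familyMonomial F '' minimalExponents ι c m) := by
  refine le_antisymm (Ideal.span_le.2 ?_) (Ideal.span_mono (Set.image_mono fun a ha => ha.1))
  rintro _ ⟨a, ha, rfl⟩
  obtain ⟨b, hba, hb⟩ := exists_le_mem_minimalExponents hc hcι ha
  exact Ideal.mem_of_dvd _ (familyMonomial_dvd hba) (Ideal.subset_span ⟨b, hb, rfl⟩)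

/-- The coefficients of a combination of minimal monomials of order `m` lying in all the powers
`(F i : i ∈ J) ^ (m + 1)` push the combination into order `m + 1`. -/
theorem IsGenericFamily.mul_familyMonomial_mem (hF : IsGenericFamily F c)
    {m : ℕ} {a : ι → ℕ} (ha : a ∈ minimalExponents ι c m) {t : ℕ} (ht : ∀ i, a i ≤ t)
    (hlt : (Finset.univ.filter fun i => a i < t).card < c) (hcι : c ≤ Fintype.card ι) {r : R}
    (hr : ∀ J : Finset ι, J.card = c → (Finset.univ.filter fun i => a i < t) ⊆ J →
      r ∈ Ideal.span (F '' (J : Set ι))) :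
    r * familyMonomial F a ∈ Ideal.span (familyMonomial F '' symbolicExponents ι c (m + 1)) := by
  set L := Finset.univ.filter fun i => a i < t with hL
  have hcompl := Finset.card_compl L
  have hLle := Finset.card_le_univ L
  have hgen : ∀ U : Finset ι,
      (∀ J : Finset ι, J.card = c → ∑ i ∈ J, a i = m → (U ∩ J).Nonempty) →
      (∏ i ∈ U, F i) * familyMonomial F a ∈
        Ideal.span (familyMonomial F '' symbolicExponents ι c (m + 1)) := by
    intro U hU
    refine Ideal.subset_span ⟨_, add_indicator_mem_symbolicExponents ha.1 hU, ?_⟩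
    rw [familyMonomial_add, familyMonomial_indicator, mul_comm]
  -- The products obtained have `|ι| + 1 - c` factors, too many to miss a set of size `c`; an index
  -- of `L` lies in every `c`-set of sum `m`.
  have h1 := hF.mem_span_sup_span_prod L Lᶜ disjoint_compl_right (c - L.card) (by omega)
    (by omega) r (fun J hJ hJc => by
      refine hr _ ?_ Finset.subset_union_left
      rw [Finset.card_union_of_disjoint (disjoint_compl_right.mono_right hJ)]
      omega)
  rw [← Ideal.span_union] at h1
  refine Submodule.span_induction ?_ (by simp) (fun _ _ _ _ h h' => ?_) (fun q _ _ h => ?_) h1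
  · rintro _ (⟨i, hi, rfl⟩ | ⟨U, ⟨-, hUc⟩, rfl⟩)
    · have := hgen {i} (fun J hJ hsum => ⟨i, by
        simpa using filter_subset_of_sum_eq ha.1 ht hlt hJ hsum hi⟩)
      rwa [Finset.prod_singleton] at this
    · refine hgen U fun J hJ _ => ?_
      by_contra h
      rw [Finset.not_nonempty_iff_eq_empty, ← Finset.disjoint_iff_inter_eq_empty] at h
      have := Finset.card_le_univ (U ∪ J)
      rw [Finset.card_union_of_disjoint h] at this
      omega
  · rw [add_mul]; exact Ideal.add_mem _ h h'
  · rw [smul_eq_mul, mul_assoc]; exact Ideal.mul_mem_left _ _ h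

theorem IsGenericFamily.iInf_span_pow_eq (hF : IsGenericFamily F c) (hc : 1 ≤ c)
    (hcι : c ≤ Fintype.card ι) (m : ℕ) :
    ⨅ J ∈ Finset.powersetCard c (Finset.univ : Finset ι), Ideal.span (F '' (J : Set ι)) ^ m =
      Ideal.span (familyMonomial F '' symbolicExponents ι c m) := by
  refine le_antisymm ?_ ?_
  · intro x hx
    simp only [Submodule.mem_iInf, Finset.mem_powersetCard, Finset.subset_univ, true_and] at hx
    induction m with
    | zero =>
      have : (1 : R) ∈ Ideal.span (familyMonomial F '' symbolicExponents ι c 0) :=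
        Ideal.subset_span ⟨0, fun _ _ => Nat.zero_le _, familyMonomial_zero⟩
      rw [(Ideal.eq_top_iff_one _).2 this]
      trivial
    | succ m ih =>
      have h1 := ih fun J hJ => Ideal.pow_le_pow_right (Nat.le_succ m) (hx J hJ)
      rw [span_symbolicExponents_eq hc hcι] at h1
      obtain ⟨r, hr, rfl⟩ := (Finsupp.mem_span_image_iff_linearCombination R).1 h1
      rw [Finsupp.linearCombination_apply]
      refine Ideal.sum_mem _ fun a ha => ?_
      have haG := hr ha
      obtain ⟨t, ht, hlt⟩ := haG.2.2
      refine hF.mul_familyMonomial_mem haG ht hlt hcι fun J hJ hLJ => ?_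
      refine hF.coeff_mem hJ.le (fun b hb hne => ?_) ?_ (hx J hJ)
      · by_contra! h
        exact hne (eq_of_mem_minimalExponents haG (hr hb) ht hlt hJ hLJ h)
      · rw [sum_eq_of_mem_minimalExponents haG.1 haG.2.1 ht hJ hLJ]
        exact Nat.lt_succ_self m
  · refine le_iInf₂ fun J hJ => Ideal.span_le.2 ?_
    rintro _ ⟨a, ha, rfl⟩
    exact familyMonomial_mem_span_pow J a (ha J (Finset.mem_powersetCard.1 hJ).2)

/-- A monomial with minimal exponent is not in the ideal generated by the others. -/
theorem IsGenericFamily.familyMonomial_notMem_span (hF : IsGenericFamily F c)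
    (hcι : c ≤ Fintype.card ι) {m : ℕ} {a : ι → ℕ} (ha : a ∈ minimalExponents ι c m) :
    familyMonomial F a ∉ Ideal.span (familyMonomial F '' (minimalExponents ι c m \ {a})) := by
  intro hmem
  obtain ⟨r, hr, hsum⟩ := (Finsupp.mem_span_image_iff_linearCombination R).1 hmem
  obtain ⟨t, ht, hlt⟩ := ha.2.2
  obtain ⟨J, hLJ, hJ⟩ := Finset.exists_superset_card_eq hlt.le hcι
  refine hF.ne_top J hJ.le ((Ideal.eq_top_iff_one _).2 ?_)
  have hra : r a = 0 := by
    by_contra h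
    exact (hr (Finsupp.mem_support_iff.2 h)).2 rfl
  -- This combination is zero, hence in every power of `(F_J)`, and its coefficient at `a` is `-1`.
  have := hF.coeff_mem hJ.le (r := r - Finsupp.single a 1) (a := a) (fun b hb hne => by
    by_contra! h
    refine hne (eq_of_mem_minimalExponents ha (hr ?_).1 ht hlt hJ hLJ h)
    simpa [Finsupp.single_apply, hne.symm] using hb) (Nat.lt_succ_self _)
    (by simp [hsum])
  simpa [hra, neg_mem_iff] using this

end Intersection

/-! ### Associated primes, and the symbolic power as an intersection of powers. -/

section SymbolicPower

variable {R : Type*} [CommRing R]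

theorem mem_associatedPrimes_quotient_iff [IsNoetherianRing R] {I P : Ideal R} :
    P ∈ associatedPrimes R (R ⧸ I) ↔ P.IsPrime ∧ ∃ r : R, ∀ x, x ∈ P ↔ x * r ∈ I := by
  rw [AssociatedPrimes.mem_iff, isAssociatedPrime_iff, (Ideal.Quotient.mk_surjective).exists]
  refine and_congr_right fun _ => exists_congr fun r => ?_
  rw [Ideal.ext_iff]
  refine forall_congr' fun x => ?_
  rw [Submodule.mem_colon_singleton, Submodule.mem_bot,
    ← Ideal.Quotient.eq_zero_iff_mem (I := I), map_mul]
  rfl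

theorem exists_mem_associatedPrimes_of_notMem [IsNoetherianRing R] {I : Ideal R} {r : R}
    (hr : r ∉ I) : ∃ P ∈ associatedPrimes R (R ⧸ I), ∀ x, x * r ∈ I → x ∈ P := by
  obtain ⟨P, hP, hle⟩ := exists_le_isAssociatedPrime_of_isNoetherianRing R
    (Ideal.Quotient.mk I r) (by rwa [Ne, Ideal.Quotient.eq_zero_iff_mem])
  refine ⟨P, hP, fun x hx => hle ?_⟩
  rw [Submodule.mem_colon_singleton, Submodule.mem_bot]
  rwa [← Ideal.Quotient.eq_zero_iff_mem, map_mul] at hx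

theorem mem_symbolicPower_iff {I : Ideal R} {m : ℕ} {x : R} :
    x ∈ symbolicPower I m ↔
      ∀ P ∈ associatedPrimes R (R ⧸ I), ∃ u, u ∉ P ∧ u * x ∈ I ^ m := by
  simp only [symbolicPower, Submodule.mem_iInf]
  refine forall₂_congr fun P hP => ?_
  have : P.IsPrime := hP.isPrime
  rw [Ideal.mem_comap, IsLocalization.algebraMap_mem_map_algebraMap_iff P.primeCompl]
  rfl

variable {s c : ℕ} {F : Fin s → R}

theorem mem_starConfigurationIdeal_iff {x : R} : x ∈ starConfigurationIdeal c F ↔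
    ∀ J : Finset (Fin s), J.card = c → x ∈ Ideal.span (F '' (J : Set (Fin s))) := by
  simp [starConfigurationIdeal, Submodule.mem_iInf, Finset.mem_powersetCard]

/-- Any other `c`-set meets the complement of `J`. So the product over `Jᶜ`, a nonzerodivisor modulo
`(F_J)`, identifies the star ideal with `(F_J)` once inverted. -/
theorem prod_compl_mul_mem_starConfigurationIdeal {J : Finset (Fin s)} (hJ : J.card = c) {x : R}
    (hx : x ∈ Ideal.span (F '' (J : Set (Fin s)))) :
    (∏ i ∈ Jᶜ, F i) * x ∈ starConfigurationIdeal c F := by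
  refine mem_starConfigurationIdeal_iff.2 fun J' hJ' => ?_
  by_cases h : J' ⊆ J
  · rw [Finset.eq_of_subset_of_card_le h (by omega)]
    exact Ideal.mul_mem_left _ _ hx
  · obtain ⟨i, hi, hiJ⟩ := Finset.not_subset.1 h
    refine Ideal.mul_mem_right _ _ (Ideal.mem_of_dvd _
      (Finset.dvd_prod_of_mem F (Finset.mem_compl.2 hiJ)) (Ideal.subset_span ⟨i, hi, rfl⟩))

theorem IsGenericFamily.mem_of_prod_compl_mul_mem (hF : IsGenericFamily F c) {J : Finset (Fin s)}
    (hJ : J.card = c) {x : R} (hx : (∏ i ∈ Jᶜ, F i) * x ∈ Ideal.span (F '' (J : Set (Fin s)))) :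
    x ∈ Ideal.span (F '' (J : Set (Fin s))) :=
  mem_of_prod_pow_mul_mem (K := Jᶜ) (fun _ => 1)
    (fun i hi => hF.mem_of_mul_mem J hJ.le i (Finset.mem_compl.1 hi)) x (by simpa using hx)

theorem IsGenericFamily.associatedPrimes_span_subset [IsNoetherianRing R]
    (hF : IsGenericFamily F c) {J : Finset (Fin s)} (hJ : J.card = c) :
    associatedPrimes R (R ⧸ Ideal.span (F '' (J : Set (Fin s)))) ⊆
      associatedPrimes R (R ⧸ starConfigurationIdeal c F) := by
  intro P hP
  obtain ⟨hprime, r, hr⟩ := mem_associatedPrimes_quotient_iff.1 hP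
  refine mem_associatedPrimes_quotient_iff.2 ⟨hprime, (∏ i ∈ Jᶜ, F i) * r, fun x => ?_⟩
  rw [hr, mul_left_comm]
  exact ⟨fun h => prod_compl_mul_mem_starConfigurationIdeal hJ h,
    fun h => hF.mem_of_prod_compl_mul_mem hJ (mem_starConfigurationIdeal_iff.1 h J hJ)⟩

/-- `P = I_c : r` is the intersection of the finitely many `(F_J) : r`, so being prime it contains
one of them. If `P` contained the product for that `J`, cancelling would give `r ∈ (F_J)` and `1 ∈
P`. -/
theorem IsGenericFamily.exists_prod_compl_notMem [IsNoetherianRing R] (hF : IsGenericFamily F c)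
    {P : Ideal R} (hP : P ∈ associatedPrimes R (R ⧸ starConfigurationIdeal c F)) :
    ∃ J : Finset (Fin s), J.card = c ∧ ∏ i ∈ Jᶜ, F i ∉ P := by
  obtain ⟨hprime, r, hr⟩ := mem_associatedPrimes_quotient_iff.1 hP
  have hle : (Finset.powersetCard c (Finset.univ : Finset (Fin s))).inf
      (fun J => (Ideal.span (F '' (J : Set (Fin s)))).colon {r}) ≤ P := by
    intro x hx
    rw [hr, mem_starConfigurationIdeal_iff]
    intro J hJ
    have := Finset.inf_le (f := fun J : Finset (Fin s) =>
      (Ideal.span (F '' (J : Set (Fin s)))).colon {r})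
      (Finset.mem_powersetCard.2 ⟨Finset.subset_univ J, hJ⟩) hx
    exact Submodule.mem_colon_singleton.1 this
  obtain ⟨J, hJmem, hJle⟩ := hprime.inf_le'.1 hle
  have hJ := (Finset.mem_powersetCard.1 hJmem).2
  refine ⟨J, hJ, fun hmem => hprime.ne_top ((Ideal.eq_top_iff_one _).2 (hJle ?_))⟩
  rw [Submodule.mem_colon_singleton, one_smul]
  exact hF.mem_of_prod_compl_mul_mem hJ (mem_starConfigurationIdeal_iff.1 ((hr _).1 hmem) J hJ)

/-- The powers `(F i : i ∈ J) ^ m` have no associated primes besides those of `(F i : i ∈ J)`. -/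
theorem IsGenericFamily.mem_span_pow_of_forall_associatedPrimes [IsNoetherianRing R]
    (hF : IsGenericFamily F c) {J : Finset (Fin s)} (hJ : J.card ≤ c) {m : ℕ} {x : R}
    (hx : ∀ P ∈ associatedPrimes R (R ⧸ Ideal.span (F '' (J : Set (Fin s)))),
      ∃ u, u ∉ P ∧ u * x ∈ Ideal.span (F '' (J : Set (Fin s))) ^ m) :
    x ∈ Ideal.span (F '' (J : Set (Fin s))) ^ m := by
  suffices ∀ l ≤ m, x ∈ Ideal.span (F '' (J : Set (Fin s))) ^ l from this m le_rfl
  intro l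
  induction l with
  | zero => simp
  | succ l ih =>
    intro hl
    obtain ⟨r, hr, rfl⟩ := (Finsupp.mem_span_image_iff_linearCombination R).1
      (span_pow_le_span_familyMonomial J l (ih (by omega)))
    rw [Finsupp.linearCombination_apply]
    refine Ideal.sum_mem _ fun a ha => ?_
    have haJ := hr ha
    rw [pow_succ']
    refine Ideal.mul_mem_mul ?_ (familyMonomial_mem_span_pow J a haJ.2.ge)
    -- A coefficient outside `(F_J)` has its annihilator modulo `(F_J)` inside an associated prime
    -- `P`; the multiplier `u ∉ P` sends `x` into `(F_J) ^ (l + 1)`, so `u` annihilates it.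
    by_contra hra
    obtain ⟨P, hP, hPle⟩ := exists_mem_associatedPrimes_of_notMem hra
    obtain ⟨u, hu, hux⟩ := hx P hP
    refine hu (hPle u ?_)
    refine hF.coeff_mem hJ (r := u • r) (a := a) (fun b hb hne => ?_)
      (l := l + 1) (by rw [haJ.2]; omega) ?_
    · have hbJ := hr (Finsupp.support_smul hb)
      -- Distinct monomials of equal degree supported on `J` cannot divide one another.
      by_contra! h
      refine hne (funext fun i => ?_)
      by_cases hi : i ∈ J
      · exact (Finset.sum_eq_sum_iff_of_le h).1 (hbJ.2.trans haJ.2.symm) i hi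
      · rw [hbJ.1 i hi, haJ.1 i hi]
    · rw [map_smul]
      exact Ideal.pow_le_pow_right hl hux

theorem IsGenericFamily.symbolicPower_starConfigurationIdeal [IsNoetherianRing R]
    (hF : IsGenericFamily F c) (m : ℕ) :
    symbolicPower (starConfigurationIdeal c F) m =
      ⨅ J ∈ Finset.powersetCard c (Finset.univ : Finset (Fin s)),
        Ideal.span (F '' (J : Set (Fin s))) ^ m := by
  ext x
  simp only [mem_symbolicPower_iff, Submodule.mem_iInf, Finset.mem_powersetCard,
    Finset.subset_univ, true_and]
  constructor
  · intro hx J hJ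
    refine hF.mem_span_pow_of_forall_associatedPrimes hJ.le fun P hP => ?_
    obtain ⟨u, hu, hux⟩ := hx P (hF.associatedPrimes_span_subset hJ hP)
    exact ⟨u, hu, Ideal.pow_right_mono
      (fun y hy => mem_starConfigurationIdeal_iff.1 hy J hJ) m hux⟩
  · intro hx P hP
    have : P.IsPrime := hP.isPrime
    obtain ⟨J, hJ, hnot⟩ := hF.exists_prod_compl_notMem hP
    refine ⟨(∏ i ∈ Jᶜ, F i) ^ m, fun h => hnot (this.mem_of_pow_mem _ h), ?_⟩
    have hle : Ideal.span {∏ i ∈ Jᶜ, F i} * Ideal.span (F '' (J : Set (Fin s))) ≤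
        starConfigurationIdeal c F := Ideal.span_singleton_mul_le_iff.2 fun z hz =>
      prod_compl_mul_mem_starConfigurationIdeal hJ hz
    refine Ideal.pow_right_mono hle m ?_
    rw [mul_pow]
    exact Ideal.mul_mem_mul (Ideal.pow_mem_pow (Ideal.mem_span_singleton_self _) m) (hx J hJ)

/-- The indices of `J`, then `v`, then enough others make `c + 1` distinct indices; regularity of
this sequence at `v` is the cancellation property. -/
theorem isGenericFamily_of_isRegular (hcs : c < s)
    (hreg : ∀ g : Fin (c + 1) → Fin s, Function.Injective g →
      RingTheory.Sequence.IsRegular R (List.ofFn (F ∘ g))) : IsGenericFamily F c := by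
  have key : ∀ J : Finset (Fin s), J.card ≤ c → ∀ v ∉ J, ∃ l : List (Fin s),
      RingTheory.Sequence.IsRegular R ((J.toList.map F) ++ F v :: l.map F) := by
    intro J hJ v hv
    obtain ⟨K, hJK, hK⟩ := Finset.exists_superset_card_eq (s := insert v J) (n := c + 1)
      (by rw [Finset.card_insert_of_notMem hv]; omega) (by rw [Fintype.card_fin]; omega)
    set l := J.toList ++ v :: (K \ insert v J).toList with hl
    have hnodup : l.Nodup := by
      simp only [hl, List.nodup_append', Finset.nodup_toList, List.nodup_cons, Finset.mem_toList,
        Finset.mem_sdiff, Finset.mem_insert, true_or, not_true_eq_false, and_false,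
        not_false_eq_true, true_and, List.disjoint_left, List.mem_cons, not_or, not_and, not_not]
      exact fun x hx => ⟨fun h => hv (h ▸ hx), fun _ _ => hx⟩
    have hlen : l.length = c + 1 := by
      have := Finset.card_sdiff_add_card_eq_card hJK
      rw [Finset.card_insert_of_notMem hv] at this
      simp only [hl, List.length_append, Finset.length_toList, List.length_cons]
      omega
    refine ⟨(K \ insert v J).toList, ?_⟩
    have := hreg (fun i => l.get (Fin.cast hlen.symm i))
      (hnodup.injective_get.comp (Fin.cast_injective _))
    convert this using 1
    have e : l.map F = J.toList.map F ++ F v :: (K \ insert v J).toList.map F := by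
      simp [hl]
    rw [← e]
    refine List.ext_getElem (by simp [hlen]) fun i h1 h2 => ?_
    rw [List.getElem_map, List.getElem_ofFn]
    rfl
  have hspan : ∀ J : Finset (Fin s), Ideal.ofList (J.toList.map F) =
      Ideal.span (F '' (J : Set (Fin s))) := by
    intro J
    rw [Ideal.ofList]
    congr 1
    ext x
    simp
  refine ⟨fun J hJ v hv x hx => ?_, fun J hJ htop => ?_⟩
  · obtain ⟨l, hl⟩ := key J hJ v hv
    have h1 := ((RingTheory.Sequence.isWeaklyRegular_append_iff R _ _).1 hl.toIsWeaklyRegular).2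
    have h2 := ((RingTheory.Sequence.isWeaklyRegular_cons_iff _ _ _).1 h1).1
    rw [hspan, smul_eq_mul, Ideal.mul_top] at h2
    rw [← Ideal.Quotient.eq_zero_iff_mem] at hx ⊢
    refine h2.right_eq_zero_of_smul ?_
    rw [← hx]
    rfl
  · obtain ⟨v, hv⟩ : ∃ v, v ∉ J := by
      by_contra! h
      have := Finset.card_eq_of_equiv_fin (n := s) (s := J) (Equiv.subtypeUnivEquiv h)
      omega
    obtain ⟨l, hl⟩ := key J hJ v hv
    refine hl.top_ne_smul ?_
    rw [Ideal.ofList_append, hspan, htop]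
    simp

end SymbolicPower

/-! ### Normal forms translated into exponents. -/

/-- The exponent of the monomial `∏ S ∈ L, ∏ i ∈ S, F i`: the `i`-th entry is the number of
members of `L` containing `i`. -/
def listExponent {s : ℕ} (L : List (Finset (Fin s))) (i : Fin s) : ℕ :=
  (L.map fun S => if i ∈ S then 1 else 0).sum

section NormalForm

variable {R : Type*} [CommRing R] {s c m : ℕ} {F : Fin s → R}

theorem listExponent_cons (S : Finset (Fin s)) (L : List (Finset (Fin s))) :
    listExponent (S :: L) = (fun i => if i ∈ S then 1 else 0) + listExponent L := by
  ext i
  simp [listExponent]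

theorem prod_map_prod_eq_familyMonomial (L : List (Finset (Fin s))) :
    (L.map fun S => ∏ i ∈ S, F i).prod = familyMonomial F (listExponent L) := by
  induction L with
  | nil => simp [listExponent, familyMonomial]
  | cons S L ih =>
    rw [listExponent_cons, familyMonomial_add, familyMonomial_indicator, ← ih, List.map_cons,
      List.prod_cons]

theorem sum_listExponent (L : List (Finset (Fin s))) (J : Finset (Fin s)) :
    ∑ i ∈ J, listExponent L i = (L.map fun S => (J ∩ S).card).sum := by
  induction L with
  | nil => simp [listExponent]
  | cons S L ih =>
    simp [listExponent_cons, Finset.sum_add_distrib, ih]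

theorem isMonomialIn_iff {M : R} : IsMonomialIn F M ↔ ∃ a, familyMonomial F a = M := by
  constructor
  · intro h
    refine Submonoid.closure_induction ?_ ⟨0, familyMonomial_zero⟩ ?_ h
    · rintro _ ⟨i, rfl⟩
      exact ⟨_, familyMonomial_single i⟩
    · rintro _ _ _ _ ⟨a, rfl⟩ ⟨b, rfl⟩
      exact ⟨_, familyMonomial_add a b⟩
  · rintro ⟨a, rfl⟩
    exact Submonoid.prod_mem _ fun i _ =>
      Submonoid.pow_mem _ (Submonoid.subset_closure (Set.mem_range_self i)) _

theorem exists_listExponent_eq (a : Fin s → ℕ) : ∃ L : List (Finset (Fin s)),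
    (∀ S ∈ L, S.Nonempty) ∧ L.Pairwise (fun S T => T ⊆ S) ∧ listExponent L = a := by
  set t := Finset.univ.sup a with ht
  -- The supports are the superlevel sets of `a`; stopping at its maximum keeps them nonempty.
  refine ⟨(List.range t).map fun j => Finset.univ.filter fun i => j < a i, ?_, ?_, ?_⟩
  · simp only [List.mem_map, List.mem_range]
    rintro _ ⟨j, hj, rfl⟩
    obtain ⟨i, -, hi⟩ := Finset.lt_sup_iff.1 hj
    exact ⟨i, by simpa using hi⟩
  · rw [List.pairwise_map]
    refine List.pairwise_lt_range.imp fun {j l} hjl i hi => ?_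
    simp only [Finset.mem_filter, Finset.mem_univ, true_and] at hi ⊢
    omega
  · ext i
    have hi : a i ≤ t := Finset.le_sup (Finset.mem_univ i)
    have hfun : ((fun S : Finset (Fin s) => if i ∈ S then 1 else 0) ∘
        fun j => Finset.univ.filter fun i => j < a i) = fun j => if j < a i then 1 else 0 := by
      ext j
      simp
    rw [listExponent, List.map_map, hfun]
    change ∑ j ∈ Finset.range t, (if j < a i then 1 else 0) = a i
    rw [Finset.sum_ite, Finset.sum_const_zero, add_zero, Finset.sum_const, smul_eq_mul, mul_one]
    have : (Finset.range t).filter (fun j => j < a i) = Finset.range (a i) := by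
      ext j
      simp only [Finset.mem_filter, Finset.mem_range]
      omega
    rw [this, Finset.card_range]

theorem isNormalForm_normalForm (a : Fin s → ℕ) :
    IsNormalForm F (familyMonomial F a) (normalForm F (familyMonomial F a)) := by
  have h : ∃ L, IsNormalForm F (familyMonomial F a) L := by
    obtain ⟨L, h1, h2, rfl⟩ := exists_listExponent_eq a
    exact ⟨L, h1, h2, prod_map_prod_eq_familyMonomial L⟩
  rw [normalForm, dif_pos h]
  exact h.choose_spec

section Chain

variable {L : List (Finset (Fin s))}

theorem listExponent_lt (hL : L.Pairwise (fun S T => T ⊆ S)) {S : Finset (Fin s)} (hS : S ∈ L)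
    {i j : Fin s} (hi : i ∉ S) (hj : j ∈ S) : listExponent L i < listExponent L j := by
  have htotal : ∀ S' ∈ L, S' ⊆ S ∨ S ⊆ S' := by
    intro S' hS'
    obtain ⟨p, hp, rfl⟩ := List.getElem_of_mem hS
    obtain ⟨q, hq, rfl⟩ := List.getElem_of_mem hS'
    rw [List.pairwise_iff_getElem] at hL
    obtain h | rfl | h := lt_trichotomy p q
    · exact Or.inl (hL p q hp hq h)
    · exact Or.inl (Finset.Subset.refl _)
    · exact Or.inr (hL q p hq hp h)
  refine List.sum_lt_sum _ _ (fun S' hS' => ?_) ⟨S, hS, by simp [hi, hj]⟩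
  by_cases hiS' : i ∈ S'
  · have hjS' : j ∈ S' := (htotal S' hS').elim (fun h => absurd (h hiS') hi) (fun h => h hj)
    simp [hiS', hjS']
  · simp [hiS']

/-- The least partial sum over `c` indices is the symbolic degree. -/
theorem exists_sum_listExponent_eq (hL : L.Pairwise (fun S T => T ⊆ S)) (hcs : c ≤ s) :
    ∃ J : Finset (Fin s), J.card = c ∧
      ∑ i ∈ J, listExponent L i = (L.map fun S => c + S.card - s).sum := by
  obtain ⟨J, hJ, -, hswap⟩ := exists_isLeast_sum (by simpa using hcs) (listExponent L)
  refine ⟨J, hJ, ?_⟩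
  rw [sum_listExponent]
  congr 1
  refine List.map_congr_left fun S hS => ?_
  have h1 := Finset.card_sdiff_add_card_inter S J
  have h2 := Finset.card_compl J
  rw [Fintype.card_fin] at h2
  rw [Finset.inter_comm S J] at h1
  have hsub : S \ J ⊆ Jᶜ := fun i hi => Finset.mem_compl.2 (Finset.mem_sdiff.1 hi).2
  have h3 := Finset.card_le_card hsub
  -- As `J` carries the smallest entries, `S` either contains `Jᶜ`, so that `|J ∩ S| = c + |S| - s`,
  -- or misses `J`, and then the truncated difference is zero.
  by_cases h : Jᶜ ⊆ S
  · have : S \ J = Jᶜ := hsub.antisymm fun i hi =>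
      Finset.mem_sdiff.2 ⟨h hi, Finset.mem_compl.1 hi⟩
    rw [this] at h1
    omega
  · obtain ⟨i, hiJ, hiS⟩ := Finset.not_subset.1 h
    have : J ∩ S = ∅ := by
      refine Finset.eq_empty_of_forall_notMem fun j hj => ?_
      rw [Finset.mem_inter] at hj
      exact (hswap i (Finset.mem_compl.1 hiJ) j hj.1).not_gt (listExponent_lt hL hS hiS hj.2)
    rw [this, Finset.card_empty] at h1 ⊢
    omega

theorem le_sum_listExponent {J : Finset (Fin s)} (hJ : J.card = c) :
    (L.map fun S => c + S.card - s).sum ≤ ∑ i ∈ J, listExponent L i := by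
  rw [sum_listExponent]
  refine List.sum_le_sum fun S _ => ?_
  have h1 := Finset.card_union_add_card_inter J S
  have h2 := Finset.card_le_univ (J ∪ S)
  rw [Fintype.card_fin] at h2
  omega

theorem listExponent_le_length (i : Fin s) : listExponent L i ≤ L.length := by
  have := List.sum_le_card_nsmul (L.map fun S => if i ∈ S then 1 else 0) 1 (by
    simp only [List.mem_map]
    rintro _ ⟨S, -, rfl⟩
    split_ifs <;> simp)
  simpa [listExponent] using this

theorem listExponent_eq_length {i : Fin s} (h : ∀ S ∈ L, i ∈ S) :
    listExponent L i = L.length := by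
  rw [listExponent, List.map_congr_left (g := fun _ => 1) fun S hS => by simp [h S hS]]
  simp

/-- An index outside a nonempty member of the chain lies strictly below the maximum. Conversely,
with `t` the length of the chain, every index of the last and smallest member attains `t`. -/
theorem listExponent_capped_iff (hL : L.Pairwise (fun S T => T ⊆ S)) (hne : ∀ S ∈ L, S.Nonempty)
    (hc : 1 ≤ c) :
    (∃ t, (∀ i, listExponent L i ≤ t) ∧
      (Finset.univ.filter fun i => listExponent L i < t).card < c) ↔
      ∀ S ∈ L, s + 1 ≤ S.card + c := by
  constructor
  · rintro ⟨t, ht, hlt⟩ S hS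
    obtain ⟨j, hj⟩ := hne S hS
    have hsub : Sᶜ ⊆ Finset.univ.filter fun i => listExponent L i < t := fun i hi => by
      have := listExponent_lt hL hS (Finset.mem_compl.1 hi) hj
      simpa using this.trans_le (ht j)
    have h1 := Finset.card_le_card hsub
    rw [Finset.card_compl, Fintype.card_fin] at h1
    omega
  · intro h
    refine ⟨L.length, listExponent_le_length, ?_⟩
    obtain rfl | hnil := eq_or_ne L []
    · simp; omega
    have hlast : ∀ S ∈ L, L.getLast hnil ⊆ S := by
      intro S hS
      rw [← List.dropLast_append_getLast hnil, List.pairwise_append] at hL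
      rw [← List.dropLast_append_getLast hnil, List.mem_append, List.mem_singleton] at hS
      rcases hS with hS | hS
      · exact hL.2.2 S hS _ (List.mem_singleton_self _)
      · exact hS ▸ Finset.Subset.refl _
    have hsub : (Finset.univ.filter fun i => listExponent L i < L.length) ⊆
        (L.getLast hnil)ᶜ := by
      intro i hi
      refine Finset.mem_compl.2 fun hmem => ?_
      have := listExponent_eq_length (L := L) fun S hS => hlast S hS hmem
      exact (Finset.mem_filter.1 hi).2.ne this
    have h1 := Finset.card_le_card hsub
    rw [Finset.card_compl, Fintype.card_fin] at h1
    have h2 := h _ (List.getLast_mem hnil)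
    have h3 := Finset.card_le_univ (L.getLast hnil)
    rw [Fintype.card_fin] at h3
    omega

theorem sum_eq_iff_listExponent (hL : L.Pairwise (fun S T => T ⊆ S)) (hcs : c ≤ s) :
    (L.map fun S => c + S.card - s).sum = m ↔
      listExponent L ∈ symbolicExponents (Fin s) c m ∧
        listExponent L ∉ symbolicExponents (Fin s) c (m + 1) := by
  obtain ⟨J, hJ, hsum⟩ := exists_sum_listExponent_eq hL hcs
  constructor
  · rintro rfl
    refine ⟨fun J' hJ' => le_sum_listExponent hJ', fun h => ?_⟩
    have := h J hJ
    omega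
  · rintro ⟨h1, h2⟩
    refine le_antisymm ?_ (hsum ▸ h1 J hJ)
    by_contra! hlt
    exact h2 fun J' hJ' => (Nat.succ_le_of_lt hlt).trans (le_sum_listExponent hJ')

end Chain

theorem IsGenericFamily.symbolicGenerators_eq (hF : IsGenericFamily F c) (hc : 1 ≤ c)
    (hcs : c ≤ s) (m : ℕ) :
    symbolicGenerators c m F = familyMonomial F '' minimalExponents (Fin s) c m := by
  have key : ∀ a, familyMonomial F a ∈ symbolicGenerators c m F ↔
      a ∈ minimalExponents (Fin s) c m := by
    intro a
    have hN := isNormalForm_normalForm (F := F) a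
    -- Whichever normal form was chosen, injectivity of `familyMonomial` recovers its exponent.
    have ha : listExponent (normalForm F (familyMonomial F a)) = a :=
      hF.familyMonomial_injective hc
        ((prod_map_prod_eq_familyMonomial _).symm.trans hN.prod_eq)
    have h1 := sum_eq_iff_listExponent (m := m) hN.decreasing hcs
    have h2 := listExponent_capped_iff hN.decreasing hN.nonempty hc
    rw [ha] at h1 h2
    change _ ∧ symbolicDegree c F _ = m ∧ _ ↔ _ ∧ _ ∧ _
    rw [symbolicDegree, h1, ← h2, and_assoc]
    exact and_iff_right (isMonomialIn_iff.2 ⟨a, rfl⟩)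
  ext M
  constructor
  · intro hM
    obtain ⟨a, rfl⟩ := isMonomialIn_iff.1 hM.1
    exact ⟨a, (key a).1 hM, rfl⟩
  · rintro ⟨a, ha, rfl⟩
    exact (key a).2 ha

end NormalForm

theorem theorem4 {k : Type*} [Field k] {n s c : ℕ} (hc : 1 ≤ c) (hcs : c < s)
    (F : Fin s → MvPolynomial (Fin (n + 1)) k)
    (hF : ∀ i, ∃ d, (F i).IsHomogeneous d)
    (hreg : ∀ g : Fin (c + 1) → Fin s, Function.Injective g →
      RingTheory.Sequence.IsRegular (MvPolynomial (Fin (n + 1)) k) (List.ofFn (F ∘ g)))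
    (m : ℕ) (hm : 1 ≤ m) :
    IsMinimalGeneratingSet (symbolicPower (starConfigurationIdeal c F) m)
      (symbolicGenerators c m F) := by
  have hgen : IsGenericFamily F c := isGenericFamily_of_isRegular hcs hreg
  have hcard : c ≤ Fintype.card (Fin s) := by simpa using hcs.le
  rw [hgen.symbolicPower_starConfigurationIdeal, hgen.iInf_span_pow_eq hc hcard,
    hgen.symbolicGenerators_eq hc hcs.le]
  refine ⟨(span_symbolicExponents_eq hc hcard m).symm, fun B hB hle => ?_⟩
  rintro _ ⟨a, ha, rfl⟩
  by_contra hnot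
  -- A generating subset `B` omitting this monomial would express it through the other minimal
  -- monomials.
  refine hgen.familyMonomial_notMem_span hcard ha ?_
  have hmem : familyMonomial F a ∈ Ideal.span B := hB ▸ Ideal.subset_span ⟨a, ha.1, rfl⟩
  refine Ideal.span_mono (fun x hx => ?_) hmem
  obtain ⟨b, hb, rfl⟩ := hle hx
  exact ⟨b, ⟨hb, fun h => hnot (Set.mem_singleton_iff.1 h ▸ hx)⟩, rfl⟩
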